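/- Let $E$ be a Polish space with its Borel $\sigma$-field, let $\alpha$ be a probability measure on $E$, let $F:E\to\mathbb R$ be measurable, and let $K\subseteq\mathbb R$ be a non-empty closed convex set. For $\lambda\in\mathbb R$ put $$\Lambda_F(\lambda)=\log\int_E e^{\lambda F}\,d\alpha\in(-\infty,+\infty],\qquad \operatorname{dom}\Lambda_F=\{\lambda\in\mathbb R:\Lambda_F(\lambda)<+\infty\}.$$ Assume that $\int_E e^{s|F|}\,d\alpha<+\infty$ for some $s>0$, that $\operatorname{dom}\Lambda_F$ is a non-empty open subset of $\mathbb R$, and that the function $\lambda\mapsto\Lambda_F(\lambda)-\inf_{y\in K}\lambda y\in(-\infty,+\infty]$ attains its minimum over $\mathbb R$. For $\varepsilon\ge0$ let $K^\varepsilon=\{x\in\mathbb R: d(x,K)\le\varepsilon\}$, and let $C_\varepsilon$ be the set of probability measures $\nu$ on $E$ such that $F$ is $\nu$-integrable and $\int F\,d\nu\in K^\varepsilon$; write $C=C_0$. Let $H(\nu\mid\alpha)$ be the relative entropy ($\int\log\frac{d\nu}{d\alpha}\,d\nu$, or $+\infty$ if this is not well defined and finite) and $H(C\mid\alpha)=\inf_{\nu\in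 C}H(\nu\mid\alpha)$. Let $X_1,X_2,\dots$ be i.i.d. with law $\alpha$, let $L_n=\frac1n\sum_{i=1}^n\delta_{X_i}$, and for $k\ge1$ let $\alpha^n_{C_\varepsilon,k}$ be the conditional law of $(X_1,\dots,X_k)$ given $L_n\in C_\varepsilon$. Then $H(C\mid\alpha)<+\infty$ and $\alpha$ has an $I$-projection $\alpha^*$ on $C$: that is, $\alpha^*\in C$, $H(\alpha^*\mid\alpha)=H(C\mid\alpha)$, and every sequence $(\nu_n)$ in $C$ with $H(\nu_n\mid\alpha)\to H(C\mid\alpha)$ converges to $\alpha^*$ in total variation. Moreover there is a constant $c>0$, depending only on $\alpha$, $F$ and $K$, such that for every real sequence $(\varepsilon_n)_{n\ge1}$ with $\varepsilon_n\to0$ and $\varepsilon_n>c/n$ for all $n\ge1$: one has $\mathbb P(L_n\in C_{\varepsilon_n})>0$ for all sufficiently large $n$, and for every $k\ge1$ $$\alpha^n_{C_{\varepsilon_n},k}\;\longrightarrow\;(\alpha^*)^{\otimes k}\qquad\text{in total variation distance, as } n\to\infty .$$ -/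

import Mathlib

open MeasureTheory ProbabilityTheory Filter Topology
open scoped ENNReal

namespace GibbsMoment

/-- Total variation distance `sup_A |μ(A) - ν(A)|` over measurable sets `A`
(used for probability measures only). -/
noncomputable def tvDist {S : Type*} [MeasurableSpace S] (μ ν : Measure S) : ℝ :=
  ⨆ A : {A : Set S // MeasurableSet A}, |μ.real A.1 - ν.real A.1|

variable {E : Type*} [MeasurableSpace E]

/-- `H(C | α) = inf {H(β | α) : β ∈ C}`, where `H` is the relative entropy
(Kullback-Leibler divergence). -/
noncomputable def entropyInf (C : Set (Measure E)) (α : Measure E) : ℝ≥0∞ :=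
  ⨅ β ∈ C, InformationTheory.klDiv β α

/-- `β` is the `I`-projection of `α` on the set `C` of probability measures: `H(C | α)` is finite,
`β` belongs to `C` and attains the infimum `H(C | α)`, and every sequence of `C` whose relative
entropy tends to `H(C | α)` converges to `β` in total variation. -/
structure IsIProjection (C : Set (Measure E)) (α β : Measure E) : Prop where
  entropyInf_lt_top : entropyInf C α < ∞
  mem : β ∈ C
  klDiv_eq : InformationTheory.klDiv β α = entropyInf C α
  tendsto_of_minimizing : ∀ ν : ℕ → Measure E, (∀ n, ν n ∈ C) →
    Tendsto (fun n => InformationTheory.klDiv (ν n) α) atTop (𝓝 (entropyInf C α)) →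
    Tendsto (fun n => tvDist (ν n) β) atTop (𝓝 0)

/-- The constraint set: probability measures `ν` such that `F` is `ν`-integrable and `∫ F dν ∈ K`. -/
def momentSet (F : E → ℝ) (K : Set ℝ) : Set (Measure E) :=
  {ν | IsProbabilityMeasure ν ∧ Integrable F ν ∧ ∫ x, F x ∂ν ∈ K}

/-- `Λ_F(l) = log ∫ exp (l F) dα`, with values in `(-∞, +∞]`. The dual of `ℝ` is identified with
`ℝ`, the number `l` acting by `y ↦ l * y`. -/
noncomputable def logLaplace (α : Measure E) (F : E → ℝ) (l : ℝ) : EReal :=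
  ENNReal.log (∫⁻ x, ENNReal.ofReal (Real.exp (l * F x)) ∂α)

/-- The domain of `Λ_F`. -/
def domLogLaplace (α : Measure E) (F : E → ℝ) : Set ℝ :=
  {l | logLaplace α F l < ⊤}

/-- `l ↦ Λ_F(l) - inf_{y ∈ K} l y`, with values in `(-∞, +∞]` when `K` is nonempty. -/
noncomputable def dualFunction (α : Measure E) (F : E → ℝ) (K : Set ℝ) (l : ℝ) : EReal :=
  logLaplace α F l - ⨅ y ∈ K, ((l * y : ℝ) : EReal)

/-- The empirical measure `L_n = (1/n) ∑_{i < n} δ_{x_i}`. -/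
noncomputable def empiricalMeasure (n : ℕ) (x : ℕ → E) : Measure E :=
  (n : ℝ≥0∞)⁻¹ • ∑ i ∈ Finset.range n, Measure.dirac (x i)

/-- The law of an i.i.d. sequence with common law `α`, on the space of sequences. -/
noncomputable def iidLaw (α : Measure E) [IsProbabilityMeasure α] : Measure (ℕ → E) :=
  Measure.infinitePi (fun _ : ℕ => α)

/-- The event `L_n ∈ C`. -/
def empiricalEvent (C : Set (Measure E)) (n : ℕ) : Set (ℕ → E) :=
  {x | empiricalMeasure n x ∈ C}

/-- The law of the first `k` members of an i.i.d. sequence with common law `α`, conditionally on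
`L_n ∈ C`. -/
noncomputable def condLaw (α : Measure E) [IsProbabilityMeasure α] (C : Set (Measure E))
    (n k : ℕ) : Measure (Fin k → E) :=
  ((iidLaw α)[|empiricalEvent C n]).map (fun x (i : Fin k) => x i)

end GibbsMoment

/-!
Let `l` minimize the dual function, let `β` be the tilt of `α` by `l * F`, and let `m` be the mean
of `F` under `β`. As the domain of `Λ_F` is open, `F` has exponential moments under `β` and `Λ_F`
is differentiable at `l` with derivative `m`. The first-order conditions
(`deriv_cgf_of_dual_minimizer`) say that `m ∈ K` and that `m` minimizes `y ↦ l * y` on `K`.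
Consequently `H(ν | β) + H(β | α) ≤ H(ν | α)` for `ν` in the constraint set, and `β` is the
I-projection (`isIProjection_tilted`); convergence of minimizing sequences follows from a form of
Pinsker's inequality.

For the conditional limit theorem, the density of the first `n` coordinates under `β` with respect
to `α` is `exp (l * S - n * Λ_F(l))`, where `S` is the sum of the `F (x i)`. On the conditioning
event `S / n` is within `ε n` of `K`, so that this density is bounded below there, and it is bounded
above on the smaller event `|S - n * m| ≤ c`. Hence the conditional law of the first `n`
coordinates is at most `exp (2 * n * |l| * ε n) / p n` times the product of `n` copies of `β`, where
`p n` is the probability of `|S - n * m| ≤ c` under `β` (`iidLaw_real_inter_mul_le`). It remains to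
see that `p n` decays subexponentially for a suitable constant `c`: a centred random walk can be
steered back to a bounded window during a small proportion of its steps
(`exists_exp_le_real_abs_sum_le`).

So conditioning only costs a factor `exp (o(n))`. Cut the first `n` coordinates into `n / k` blocks
of length `k`. By Hoeffding's inequality the frequency of the blocks lying in a set `D` differs from
its mean by `δ` with exponentially small probability under `β`, uniformly in `D`, hence also under
the conditional law. By exchangeability the conditional probability that the first block lies in
`D` is the conditional mean of this frequency (`abs_iidLaw_real_inter_sub_le`), which gives the
convergence in total variation.
-/

namespace GibbsMoment

variable {E : Type*} [MeasurableSpace E]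

/-! ### The dual problem -/

theorem lintegral_exp_lt_top_iff {α : Measure E} {F : E → ℝ} (hF : Measurable F) (l : ℝ) :
    ∫⁻ x, ENNReal.ofReal (Real.exp (l * F x)) ∂α < ∞ ↔ l ∈ integrableExpSet F α := by
  rw [lt_top_iff_ne_top, lintegral_ofReal_ne_top_iff_integrable (by fun_prop)
    (ae_of_all _ fun _ => (Real.exp_pos _).le)]
  rfl

theorem domLogLaplace_eq_integrableExpSet {α : Measure E} {F : E → ℝ} (hF : Measurable F) :
    domLogLaplace α F = integrableExpSet F α := by
  ext l
  rw [← lintegral_exp_lt_top_iff hF]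
  simp [domLogLaplace, logLaplace]

theorem logLaplace_eq_cgf {α : Measure E} [IsProbabilityMeasure α] {F : E → ℝ} {l : ℝ}
    (hl : l ∈ integrableExpSet F α) : logLaplace α F l = (cgf F α l : EReal) := by
  rw [logLaplace, ← ofReal_integral_eq_lintegral_ofReal hl
    (ae_of_all _ fun _ => (Real.exp_pos _).le), ENNReal.log_ofReal_of_pos (integral_exp_pos hl)]
  rfl

/-- The minimality of `l₀` for the dual function in terms of real numbers: `s` is
`inf_{y ∈ K} l₀ * y`, and any lower bound `r` of `l * y` on `K` may replace `inf_{y ∈ K} l * y` in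
the value of the dual function at `l`. -/
theorem exists_cgf_sub_le_of_dualFunction_le {α : Measure E} [IsProbabilityMeasure α] {F : E → ℝ}
    (hF : Measurable F) {K : Set ℝ} (hK : K.Nonempty) {l₀ : ℝ}
    (h : ∀ l, dualFunction α F K l₀ ≤ dualFunction α F K l) :
    l₀ ∈ integrableExpSet F α ∧ ∃ s : ℝ, (∀ y ∈ K, s ≤ l₀ * y) ∧
      ∀ l ∈ integrableExpSet F α, ∀ r : ℝ, (∀ y ∈ K, r ≤ l * y) →
        cgf F α l₀ - s ≤ cgf F α l - r := by
  obtain ⟨y₀, hy₀⟩ := hK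
  have hlt (l : ℝ) : ⨅ y ∈ K, ((l * y : ℝ) : EReal) ≤ ((l * y₀ : ℝ) : EReal) := iInf₂_le y₀ hy₀
  have hub (l : ℝ) (hl : l ∈ integrableExpSet F α) (r : ℝ) (hr : ∀ y ∈ K, r ≤ l * y) :
      dualFunction α F K l ≤ ((cgf F α l - r : ℝ) : EReal) := by
    rw [dualFunction, logLaplace_eq_cgf hl, EReal.coe_sub]
    refine EReal.sub_le_sub le_rfl ?_
    exact le_iInf₂ fun y hy => by exact_mod_cast hr y hy
  have h0 : (0 : ℝ) ∈ integrableExpSet F α := by simp [integrableExpSet]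
  have hfin : dualFunction α F K l₀ < ⊤ :=
    ((h 0).trans (hub 0 h0 0 (by simp))).trans_lt (EReal.coe_lt_top _)
  have hl₀ : l₀ ∈ integrableExpSet F α := by
    by_contra hcon
    rw [← lintegral_exp_lt_top_iff hF, not_lt, top_le_iff] at hcon
    rw [dualFunction, logLaplace, hcon, ENNReal.log_top,
      EReal.top_sub ((hlt l₀).trans_lt (EReal.coe_lt_top _)).ne] at hfin
    exact lt_irrefl _ hfin
  refine ⟨hl₀, ?_⟩
  have hbot : ⨅ y ∈ K, ((l₀ * y : ℝ) : EReal) ≠ ⊥ := by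
    intro hcon
    rw [dualFunction, logLaplace_eq_cgf hl₀, hcon] at hfin
    simp at hfin
  have htop := ((hlt l₀).trans_lt (EReal.coe_lt_top _)).ne
  have hs := EReal.coe_toReal htop hbot
  refine ⟨(⨅ y ∈ K, ((l₀ * y : ℝ) : EReal)).toReal, fun y hy => ?_, fun l hl r hr => ?_⟩
  · rw [← EReal.coe_le_coe_iff, hs]
    exact iInf₂_le y hy
  · have := (h l).trans (hub l hl r hr)
    rw [dualFunction, logLaplace_eq_cgf hl₀, ← hs] at this
    exact_mod_cast this

/-- First-order conditions at a minimizer `l₀` of the dual function: the mean of `F` under the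
exponential tilt of parameter `l₀` lies in `K` and minimizes `y ↦ l₀ * y` on `K`. Membership comes
from perturbing `l₀` along a functional separating the mean from `K`, minimality from perturbing
`l₀` along the ray `(1 - t) * l₀`. -/
theorem deriv_cgf_of_dual_minimizer {α : Measure E} [IsProbabilityMeasure α] {F : E → ℝ}
    {K : Set ℝ} (hKc : IsClosed K) (hKv : Convex ℝ K) {l₀ s : ℝ}
    (hl₀ : l₀ ∈ interior (integrableExpSet F α)) (hs : ∀ y ∈ K, s ≤ l₀ * y)
    (hmin : ∀ l ∈ integrableExpSet F α, ∀ r : ℝ, (∀ y ∈ K, r ≤ l * y) →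
      cgf F α l₀ - s ≤ cgf F α l - r) :
    deriv (cgf F α) l₀ ∈ K ∧ ∀ y ∈ K, l₀ * deriv (cgf F α) l₀ ≤ l₀ * y := by
  set m := deriv (cgf F α) l₀
  have hd : HasDerivAt (cgf F α) m l₀ := (analyticAt_cgf hl₀).differentiableAt.hasDerivAt
  have hnhds : ∀ᶠ l in 𝓝 l₀, l ∈ integrableExpSet F α :=
    mem_interior_iff_mem_nhds.1 hl₀
  -- The increment of the dual function along `l₀ + t * v`, with `inf_{y ∈ K} (l₀ + t * v) * y`
  -- replaced by an affine function `s + t * u` of `t`.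
  have hline (v u : ℝ) :
      HasDerivAt (fun t : ℝ => cgf F α (l₀ + t * v) - (s + t * u)) (m * v - u) 0 := by
    have h1 : HasDerivAt (fun t : ℝ => l₀ + t * v) v 0 := by
      simpa using ((hasDerivAt_id (0 : ℝ)).mul_const v).const_add l₀
    have h2 : HasDerivAt (fun t : ℝ => s + t * u) u 0 := by
      simpa using ((hasDerivAt_id (0 : ℝ)).mul_const u).const_add s
    have h3 : HasDerivAt (cgf F α) m (l₀ + 0 * v) := by simpa using hd
    exact (h3.comp (0 : ℝ) h1).sub h2
  have hev (v : ℝ) : ∀ᶠ t : ℝ in 𝓝 0, l₀ + t * v ∈ integrableExpSet F α := by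
    have : Tendsto (fun t : ℝ => l₀ + t * v) (𝓝 0) (𝓝 l₀) :=
      Continuous.tendsto' (by fun_prop) _ _ (by simp)
    exact this.eventually hnhds
  constructor
  · by_contra hmem
    obtain ⟨f, u, hfu, hf⟩ := geometric_hahn_banach_point_closed hKv hKc hmem
    have hfe (y : ℝ) : f y = f 1 * y := by
      have := f.map_smul y 1
      simpa [mul_comm] using this
    have hneg : m * f 1 - u < 0 := by
      rw [hfe] at hfu
      linarith
    have h1 := (hline (f 1) u).hasDerivWithinAt (s := Set.Ioi 0)
    have h2 := h1.limsup_slope_le' (by simp) hneg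
    obtain ⟨t, ht, hts, htpos⟩ := (h2.and (((hev (f 1)).filter_mono nhdsWithin_le_nhds).and
      self_mem_nhdsWithin)).exists
    have htpos : 0 < t := htpos
    have h3 := hmin _ hts (s + t * u) fun y hy => by
      have := hf y hy
      rw [hfe] at this
      nlinarith [hs y hy, mul_le_mul_of_nonneg_left this.le htpos.le]
    rw [slope_def_field, sub_zero, div_neg_iff] at ht
    simp only [zero_mul, add_zero] at ht
    rcases ht with h | h <;> linarith
  · have hloc : IsLocalMin (fun t : ℝ => cgf F α (l₀ + t * -l₀) - (s + t * -s)) 0 := by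
      filter_upwards [hev (-l₀), Iio_mem_nhds (zero_lt_one' ℝ)] with t ht ht1
      have ht1 : t < 1 := ht1
      have h3 := hmin _ ht (s + t * -s) fun y hy => by
        nlinarith [mul_le_mul_of_nonneg_left (hs y hy) (sub_nonneg.2 ht1.le)]
      simpa using h3
    have := hloc.hasDerivAt_eq_zero (hline _ _)
    intro y hy
    linarith [hs y hy]

/-! ### Relative entropy and total variation -/

theorem sq_sqrt_sub_one_le_klFun {x : ℝ} (hx : 0 ≤ x) :
    (√x - 1) ^ 2 ≤ InformationTheory.klFun x := by
  rcases hx.eq_or_lt with rfl | hx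
  · simp [InformationTheory.klFun_zero]
  have h0 : 0 < √x := Real.sqrt_pos.2 hx
  have h1 := Real.one_sub_inv_le_log_of_pos h0
  have h2 : Real.log x = 2 * Real.log (√x) := by
    rw [Real.log_sqrt hx.le]
    ring
  have h3 := Real.sq_sqrt hx.le
  rw [InformationTheory.klFun_apply, h2]
  have h4 : x * (1 - (√x)⁻¹) = x - √x := by
    rw [mul_sub, mul_one]
    congr 1
    field_simp
    exact h3.symm
  nlinarith [mul_le_mul_of_nonneg_left h1 hx.le]

/-- Arithmetic-geometric mean applied to `|x - 1| = |√x - 1| * (√x + 1)`. Integrated against a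
reference measure, it is a form of Pinsker's inequality without the optimal constant. -/
theorem abs_sub_one_le_klFun {x t : ℝ} (hx : 0 ≤ x) (ht : 0 < t) :
    |x - 1| ≤ InformationTheory.klFun x / (2 * t) + t * (x + 1) := by
  have h1 := sq_sqrt_sub_one_le_klFun hx
  have h2 := Real.sq_sqrt hx
  have h3 : |x - 1| = |√x - 1| * (√x + 1) := by
    rw [← abs_of_nonneg (by positivity : 0 ≤ √x + 1), ← abs_mul]
    congr 1
    nlinarith
  have h4 : |√x - 1| ^ 2 = (√x - 1) ^ 2 := sq_abs _
  rw [h3, div_add' _ _ _ (by positivity), le_div_iff₀ (by positivity)]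
  have h5 : t ^ 2 * (√x + 1) ^ 2 ≤ t ^ 2 * (2 * (x + 1)) :=
    mul_le_mul_of_nonneg_left (by nlinarith [sq_nonneg (√x - 1)]) (sq_nonneg t)
  nlinarith [sq_nonneg (|√x - 1| - t * (√x + 1))]

theorem abs_measureReal_sub_le_klDiv {μ ν : Measure E} [IsProbabilityMeasure μ]
    [IsProbabilityMeasure ν] (h : InformationTheory.klDiv μ ν ≠ ∞) {t : ℝ} (ht : 0 < t)
    (A : Set E) :
    |μ.real A - ν.real A| ≤ (InformationTheory.klDiv μ ν).toReal / (2 * t) + 2 * t := by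
  obtain ⟨hac, hint⟩ := InformationTheory.klDiv_ne_top_iff.1 h
  have hi1 : Integrable (fun x => (μ.rnDeriv ν x).toReal) ν := Measure.integrable_toReal_rnDeriv
  have hi2 := (InformationTheory.integrable_klFun_rnDeriv_iff hac).2 hint
  have hi3 : Integrable (fun x => |(μ.rnDeriv ν x).toReal - 1|) ν :=
    (hi1.sub (integrable_const 1)).abs
  have hi4 : Integrable (fun x => t * ((μ.rnDeriv ν x).toReal + 1)) ν :=
    (hi1.add (integrable_const 1)).const_mul t
  have e1 : ∫ x, (μ.rnDeriv ν x).toReal ∂ν = 1 := by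
    rw [Measure.integral_toReal_rnDeriv hac, probReal_univ]
  calc |μ.real A - ν.real A| = |∫ x in A, ((μ.rnDeriv ν x).toReal - 1) ∂ν| := by
        rw [integral_sub hi1.integrableOn (integrable_const 1).integrableOn,
          Measure.setIntegral_toReal_rnDeriv hac]
        simp
    _ ≤ ∫ x in A, |(μ.rnDeriv ν x).toReal - 1| ∂ν := abs_integral_le_integral_abs
    _ ≤ ∫ x, |(μ.rnDeriv ν x).toReal - 1| ∂ν :=
        setIntegral_le_integral hi3 (ae_of_all _ fun _ => abs_nonneg _)
    _ ≤ ∫ x, (InformationTheory.klFun (μ.rnDeriv ν x).toReal / (2 * t)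
          + t * ((μ.rnDeriv ν x).toReal + 1)) ∂ν :=
        integral_mono hi3 ((hi2.div_const _).add hi4)
          fun x => abs_sub_one_le_klFun ENNReal.toReal_nonneg ht
    _ = _ := by
        rw [integral_add (hi2.div_const _) hi4,
          integral_div, integral_const_mul, integral_add hi1 (integrable_const 1), e1,
          InformationTheory.toReal_klDiv_eq_integral_klFun hac]
        simp
        ring

theorem tvDist_nonneg {S : Type*} [MeasurableSpace S] (μ ν : Measure S) : 0 ≤ tvDist μ ν :=
  Real.iSup_nonneg fun _ => abs_nonneg _

theorem tvDist_le {S : Type*} [MeasurableSpace S] {μ ν : Measure S} {r : ℝ}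
    (h : ∀ A, MeasurableSet A → |μ.real A - ν.real A| ≤ r) : tvDist μ ν ≤ r := by
  have : Nonempty {A : Set S // MeasurableSet A} := ⟨⟨∅, .empty⟩⟩
  exact ciSup_le fun A => h A.1 A.2

theorem tendsto_tvDist_of_tendsto_klDiv {μ : ℕ → Measure E} {ν : Measure E}
    [∀ n, IsProbabilityMeasure (μ n)] [IsProbabilityMeasure ν]
    (h : Tendsto (fun n => InformationTheory.klDiv (μ n) ν) atTop (𝓝 0)) :
    Tendsto (fun n => tvDist (μ n) ν) atTop (𝓝 0) := by
  refine Metric.tendsto_atTop'.2 fun δ hδ => ?_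
  have h1 := h.eventually_lt_const (ENNReal.ofReal_pos.2 (by positivity : 0 < (δ / 4) ^ 2))
  obtain ⟨N, hN⟩ := eventually_atTop.1 h1
  refine ⟨N, fun n hn => ?_⟩
  have h2 := hN n hn.le
  have h3 : (InformationTheory.klDiv (μ n) ν).toReal ≤ (δ / 4) ^ 2 :=
    ENNReal.toReal_le_of_le_ofReal (by positivity) h2.le
  rw [Real.dist_eq, sub_zero, abs_of_nonneg (tvDist_nonneg _ _)]
  have h4 : tvDist (μ n) ν ≤ (δ / 4) ^ 2 / (2 * (δ / 4)) + 2 * (δ / 4) := by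
    refine tvDist_le fun A _ => ?_
    refine (abs_measureReal_sub_le_klDiv h2.ne_top (by positivity : 0 < δ / 4) A).trans ?_
    gcongr
  have h5 : (δ / 4) ^ 2 / (2 * (δ / 4)) + 2 * (δ / 4) = 5 * δ / 8 := by
    field_simp
    ring
  linarith

/-! ### The I-projection -/

section Tilted
variable {α : Measure E} [IsProbabilityMeasure α] {F : E → ℝ} {l : ℝ}

theorem isProbabilityMeasure_tilted_mul (hl : l ∈ integrableExpSet F α) :
    IsProbabilityMeasure (α.tilted (l * F ·)) :=
  isProbabilityMeasure_tilted hl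

/-- Finiteness and value of the relative entropy with respect to a tilt:
`H(ν | α_l) = H(ν | α) - (l * ∫ F dν - Λ_F(l))`, where `α_l` is the tilt of `α` by `l * F`. -/
theorem klDiv_tilted_right_eq (hl : l ∈ integrableExpSet F α) {ν : Measure E}
    [IsProbabilityMeasure ν] (hν : Integrable F ν) (h : InformationTheory.klDiv ν α ≠ ∞) :
    InformationTheory.klDiv ν (α.tilted (l * F ·)) ≠ ∞ ∧
      (InformationTheory.klDiv ν (α.tilted (l * F ·))).toReal
        = (InformationTheory.klDiv ν α).toReal - (l * ∫ x, F x ∂ν - cgf F α l) := by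
  have := isProbabilityMeasure_tilted_mul hl
  obtain ⟨hac, hint⟩ := InformationTheory.klDiv_ne_top_iff.1 h
  have hac' : ν ≪ α.tilted (l * F ·) := hac.trans (absolutelyContinuous_tilted hl)
  refine ⟨InformationTheory.klDiv_ne_top hac' (integrable_llr_tilted_right hac (hν.const_mul l)
    hint hl), ?_⟩
  rw [InformationTheory.toReal_klDiv_of_measure_eq hac' (by simp),
    InformationTheory.toReal_klDiv_of_measure_eq hac (by simp),
    integral_llr_tilted_right hac (hν.const_mul l) hl hint, integral_const_mul, cgf, mgf]
  ring

theorem klDiv_tilted_left_ne_top (hl : l ∈ integrableExpSet F α)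
    (hF : Integrable F (α.tilted (l * F ·))) :
    InformationTheory.klDiv (α.tilted (l * F ·)) α ≠ ∞ := by
  have := isProbabilityMeasure_tilted_mul hl
  have hac := tilted_absolutelyContinuous α (l * F ·)
  refine InformationTheory.klDiv_ne_top hac ?_
  have h1 : llr (α.tilted (l * F ·)) α =ᵐ[α.tilted (l * F ·)]
      fun x => l * F x - Real.log (∫ x, Real.exp (l * F x) ∂α) :=
    hac.ae_le (log_rnDeriv_tilted_left_self hl)
  rw [integrable_congr h1]
  exact (hF.const_mul l).sub (integrable_const _)

/-- If the tilt `β` of `α` by `l * F` has mean in `K`, and this mean minimizes `y ↦ l * y` on `K`,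
then `H(ν | β) + H(β | α) ≤ H(ν | α)` for all `ν` in the constraint set, which makes `β` the
I-projection. -/
theorem isIProjection_tilted {K : Set ℝ} (hl : l ∈ integrableExpSet F α)
    (hF : Integrable F (α.tilted (l * F ·))) (hmem : ∫ x, F x ∂(α.tilted (l * F ·)) ∈ K)
    (hmin : ∀ y ∈ K, l * ∫ x, F x ∂(α.tilted (l * F ·)) ≤ l * y) :
    IsIProjection (momentSet F K) α (α.tilted (l * F ·)) := by
  set β := α.tilted (l * F ·) with hβ
  have hβp : IsProbabilityMeasure β := isProbabilityMeasure_tilted_mul hl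
  have hfin : InformationTheory.klDiv β α ≠ ∞ := klDiv_tilted_left_ne_top hl hF
  have hβC : β ∈ momentSet F K := ⟨hβp, hF, hmem⟩
  have hβeq : (InformationTheory.klDiv β α).toReal = l * ∫ x, F x ∂β - cgf F α l := by
    have := (klDiv_tilted_right_eq hl hF hfin).2
    rw [← hβ, InformationTheory.klDiv_self, ENNReal.toReal_zero] at this
    linarith
  have hpyth (ν : Measure E) (hν : ν ∈ momentSet F K) :
      InformationTheory.klDiv ν β + InformationTheory.klDiv β α
        ≤ InformationTheory.klDiv ν α := by
    obtain ⟨hνp, hνF, hνK⟩ := hν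
    by_cases h : InformationTheory.klDiv ν α = ∞
    · simp [h]
    obtain ⟨h1, h2⟩ := klDiv_tilted_right_eq hl hνF h
    rw [← hβ] at h1 h2
    rw [← ENNReal.toReal_le_toReal (ENNReal.add_ne_top.2 ⟨h1, hfin⟩) h,
      ENNReal.toReal_add h1 hfin]
    linarith [hmin _ hνK]
  have heq : InformationTheory.klDiv β α = entropyInf (momentSet F K) α :=
    le_antisymm (le_iInf₂ fun ν hν => le_add_self.trans (hpyth ν hν)) (iInf₂_le β hβC)
  refine ⟨heq ▸ hfin.lt_top, hβC, heq, fun ν hν hlim => ?_⟩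
  have _ (n : ℕ) : IsProbabilityMeasure (ν n) := (hν n).1
  refine tendsto_tvDist_of_tendsto_klDiv ?_
  rw [← heq] at hlim
  have h1 : Tendsto (fun n => InformationTheory.klDiv (ν n) α - InformationTheory.klDiv β α)
      atTop (𝓝 0) := by
    have := ENNReal.Tendsto.sub hlim (tendsto_const_nhds (x := InformationTheory.klDiv β α))
      (Or.inl hfin)
    simpa using this
  refine tendsto_of_tendsto_of_tendsto_of_le_of_le tendsto_const_nhds h1 (fun n => zero_le)
    fun n => ?_
  exact ENNReal.le_sub_of_add_le_right hfin (hpyth _ (hν n))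

end Tilted

/-! ### Random walk: a subexponential lower bound for bounded windows -/

instance (α : Measure E) [IsProbabilityMeasure α] : IsProbabilityMeasure (iidLaw α) := by
  unfold iidLaw
  infer_instance

section RandomWalk
variable {β : Measure E} [IsProbabilityMeasure β] {Y : E → ℝ}

theorem indepFun_sum_range_iidLaw (hY : Measurable Y) (n : ℕ) :
    IndepFun (fun x : ℕ → E => ∑ i ∈ Finset.range n, Y (x i)) (fun x => Y (x n)) (iidLaw β) := by
  have h : iIndepFun (fun (i : ℕ) (x : ℕ → E) => Y (x i)) (iidLaw β) :=
    iIndepFun_infinitePi (P := fun _ => β) (X := fun _ => Y) fun _ => hY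
  have := h.indepFun_sum_range_succ (fun i => by fun_prop) n
  simpa [Finset.sum_fn] using this

theorem iidLaw_real_eval (n : ℕ) {s : Set E} (hs : MeasurableSet s) :
    (iidLaw β).real {x | x n ∈ s} = β.real s := by
  have := (measurePreserving_eval_infinitePi (fun _ : ℕ => β) n).measureReal_preimage
    hs.nullMeasurableSet
  exact this

/-- One step of steering. If a step of size between `a` and `b` is available in each direction
with probability at least `p`, then a walk inside `[-(r + a), r + a]` enters `[-r, r]` at the next
step with probability at least `p`, by moving towards the origin. -/
theorem mul_real_abs_sum_le {a b p r : ℝ} (hY : Measurable Y)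
    (hp₁ : p ≤ β.real {z | Y z ∈ Set.Icc a b}) (hp₂ : p ≤ β.real {z | Y z ∈ Set.Icc (-b) (-a)})
    (hr : b ≤ r) (n : ℕ) :
    p * (iidLaw β).real {x | |∑ i ∈ Finset.range n, Y (x i)| ≤ r + a}
      ≤ (iidLaw β).real {x | |∑ i ∈ Finset.range (n + 1), Y (x i)| ≤ r} := by
  set S : (ℕ → E) → ℝ := fun x => ∑ i ∈ Finset.range n, Y (x i) with hS
  have hSm : Measurable S := by fun_prop
  have hind (I J : Set ℝ) (hI : MeasurableSet I) (hJ : MeasurableSet J) :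
      (iidLaw β).real ({x | S x ∈ I} ∩ {x | Y (x n) ∈ J})
        = (iidLaw β).real {x | S x ∈ I} * β.real {z | Y z ∈ J} := by
    have h := iidLaw_real_eval (β := β) n (s := {z | Y z ∈ J}) (hY hJ)
    rw [← h, measureReal_def, measureReal_def, measureReal_def,
      ← ENNReal.toReal_mul]
    congr 1
    exact (indepFun_sum_range_iidLaw hY n).measure_inter_preimage_eq_mul I J hI hJ
  have h1 := hind (Set.Ioc 0 (r + a)) (Set.Icc (-b) (-a)) measurableSet_Ioc measurableSet_Icc
  have h2 := hind (Set.Icc (-(r + a)) 0) (Set.Icc a b) measurableSet_Icc measurableSet_Icc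
  have hsplit : (iidLaw β).real {x | |S x| ≤ r + a}
      ≤ (iidLaw β).real {x | S x ∈ Set.Ioc 0 (r + a)}
        + (iidLaw β).real {x | S x ∈ Set.Icc (-(r + a)) 0} := by
    refine (measureReal_mono ?_).trans (measureReal_union_le _ _)
    intro x hx
    simp only [Set.mem_ofPred_eq, abs_le, Set.mem_union, Set.mem_Ioc, Set.mem_Icc] at hx ⊢
    rcases lt_or_ge 0 (S x) with h | h
    · exact Or.inl ⟨h, hx.2⟩
    · exact Or.inr ⟨hx.1, h⟩
  have hdisj : Disjoint ({x | S x ∈ Set.Ioc 0 (r + a)} ∩ {x | Y (x n) ∈ Set.Icc (-b) (-a)})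
      ({x | S x ∈ Set.Icc (-(r + a)) 0} ∩ {x | Y (x n) ∈ Set.Icc a b}) := by
    rw [Set.disjoint_left]
    rintro x ⟨hx, -⟩ ⟨hx', -⟩
    exact absurd hx.1 (not_lt.2 hx'.2)
  have hmeas : MeasurableSet ({x | S x ∈ Set.Icc (-(r + a)) 0} ∩ {x | Y (x n) ∈ Set.Icc a b}) :=
    (hSm measurableSet_Icc).inter ((hY.comp (measurable_pi_apply n)) measurableSet_Icc)
  calc p * (iidLaw β).real {x | |S x| ≤ r + a}
      ≤ (iidLaw β).real {x | |S x| ≤ r + a} * p := (mul_comm _ _).le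
    _ ≤ (iidLaw β).real {x | S x ∈ Set.Ioc 0 (r + a)} * β.real {z | Y z ∈ Set.Icc (-b) (-a)}
        + (iidLaw β).real {x | S x ∈ Set.Icc (-(r + a)) 0} * β.real {z | Y z ∈ Set.Icc a b} := by
      by_cases hp : 0 ≤ p
      · calc _ ≤ _ := mul_le_mul_of_nonneg_right hsplit hp
          _ ≤ _ := by
            rw [add_mul]
            gcongr
      · refine (mul_nonpos_of_nonneg_of_nonpos measureReal_nonneg (not_le.1 hp).le).trans ?_
        positivity
    _ = (iidLaw β).real (({x | S x ∈ Set.Ioc 0 (r + a)} ∩ {x | Y (x n) ∈ Set.Icc (-b) (-a)}) ∪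
          ({x | S x ∈ Set.Icc (-(r + a)) 0} ∩ {x | Y (x n) ∈ Set.Icc a b})) := by
      rw [measureReal_union hdisj hmeas, h1, h2]
    _ ≤ _ := by
      refine measureReal_mono ?_
      intro x hx
      simp only [Set.mem_ofPred_eq, abs_le, Set.mem_union, Set.mem_inter_iff, Set.mem_Ioc,
        Set.mem_Icc, Finset.sum_range_succ] at hx ⊢
      rcases hx with hx | hx <;> constructor <;> linarith

theorem pow_mul_real_abs_sum_le {a b p : ℝ} (hY : Measurable Y) (hp : 0 ≤ p)
    (hp₁ : p ≤ β.real {z | Y z ∈ Set.Icc a b}) (hp₂ : p ≤ β.real {z | Y z ∈ Set.Icc (-b) (-a)})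
    (ha : 0 < a) (m n : ℕ) {r : ℝ} (hr : b ≤ r) :
    p ^ m * (iidLaw β).real {x | |∑ i ∈ Finset.range n, Y (x i)| ≤ r + m * a}
      ≤ (iidLaw β).real {x | |∑ i ∈ Finset.range (n + m), Y (x i)| ≤ r} := by
  induction m generalizing r with
  | zero => simp
  | succ m ih =>
    have h1 := ih (r := r + a) (by linarith)
    have h2 := mul_real_abs_sum_le hY hp₁ hp₂ hr (n + m)
    have e : r + ((m + 1 : ℕ) : ℝ) * a = r + a + m * a := by
      push_cast
      ring
    rw [e, pow_succ', mul_assoc]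
    exact (mul_le_mul_of_nonneg_left h1 hp).trans h2

theorem exists_pos_real_Icc {Z : E → ℝ} (h : 0 < β {z | 0 < Z z}) :
    ∃ N : ℕ, ∀ j ≥ N, 0 < β.real {z | Z z ∈ Set.Icc (1 / ((j : ℝ) + 1)) (j + 1)} := by
  have hU : {z | 0 < Z z} = ⋃ j : ℕ, {z | Z z ∈ Set.Icc (1 / ((j : ℝ) + 1)) (j + 1)} := by
    ext z
    simp only [Set.mem_ofPred_eq, Set.mem_iUnion, Set.mem_Icc]
    constructor
    · intro hz
      obtain ⟨j₁, hj₁⟩ := exists_nat_one_div_lt hz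
      obtain ⟨j₂, hj₂⟩ := exists_nat_ge (Z z)
      refine ⟨max j₁ j₂, ?_, ?_⟩
      · refine le_trans ?_ hj₁.le
        have : (j₁ : ℝ) ≤ (max j₁ j₂ : ℕ) := by exact_mod_cast le_max_left _ _
        gcongr
      · have : (j₂ : ℝ) ≤ (max j₁ j₂ : ℕ) := by exact_mod_cast le_max_right _ _
        linarith
    · rintro ⟨j, hj, -⟩
      exact lt_of_lt_of_le (by positivity) hj
  rw [hU] at h
  obtain ⟨N, hN⟩ := exists_measure_pos_of_not_measure_iUnion_null h.ne'
  refine ⟨N, fun j hj => ?_⟩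
  refine (ENNReal.toReal_pos hN.ne' (measure_ne_top _ _)).trans_le (measureReal_mono ?_)
  intro z hz
  have : (N : ℝ) ≤ j := by exact_mod_cast hj
  simp only [Set.mem_ofPred_eq, Set.mem_Icc] at hz ⊢
  refine ⟨le_trans ?_ hz.1, by linarith [hz.2]⟩
  gcongr

/-- A centred step that does not vanish almost surely takes values of both signs, bounded and
bounded away from zero, with positive probability. -/
theorem exists_steps (hYi : Integrable Y β) (h0 : ∫ z, Y z ∂β = 0) (hne : ¬ Y =ᵐ[β] 0) :
    ∃ a b p : ℝ, 0 < a ∧ 0 < b ∧ 0 < p ∧ p ≤ β.real {z | Y z ∈ Set.Icc a b} ∧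
      p ≤ β.real {z | Y z ∈ Set.Icc (-b) (-a)} := by
  have hpos (Z : E → ℝ) (hZ : Integrable Z β) (hZ0 : ∫ z, Z z ∂β = 0) (hZne : ¬ Z =ᵐ[β] 0) :
      0 < β {z | 0 < Z z} := by
    rw [pos_iff_ne_zero]
    intro hcon
    apply hZne
    have h1 : 0 ≤ᵐ[β] fun z => -Z z := by
      have : ∀ᵐ z ∂β, ¬ 0 < Z z := by
        rw [ae_iff]
        simpa using hcon
      filter_upwards [this] with z hz
      simpa using hz
    have h2 := (integral_eq_zero_iff_of_nonneg_ae h1 hZ.neg).1 (by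
      change ∫ z, -Z z ∂β = 0
      rw [integral_neg, hZ0, neg_zero])
    filter_upwards [h2] with z hz
    simpa using hz
  obtain ⟨N₁, h₁⟩ := exists_pos_real_Icc (hpos Y hYi h0 hne)
  obtain ⟨N₂, h₂⟩ := exists_pos_real_Icc (hpos (fun z => -Y z) hYi.neg
    (by rw [integral_neg, h0, neg_zero]) fun h => hne (by
      filter_upwards [h] with z hz
      simpa using hz))
  set j := max N₁ N₂
  have h₁ := h₁ j (le_max_left _ _)
  have h₂ := h₂ j (le_max_right _ _)
  refine ⟨1 / ((j : ℝ) + 1), j + 1, _, by positivity, by positivity, lt_min h₁ h₂,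
    min_le_left _ _, (min_le_right _ _).trans (le_of_eq ?_)⟩
  congr 1
  ext z
  simp only [Set.mem_ofPred_eq, Set.mem_Icc]
  constructor <;> rintro ⟨h, h'⟩ <;> constructor <;> linarith

/-- Chebyshev's inequality for the sums of a centred i.i.d. sequence. -/
theorem real_abs_sum_ge_le (hY : Measurable Y) (hY2 : MemLp Y 2 β) (h0 : ∫ z, Y z ∂β = 0)
    (n : ℕ) {t : ℝ} (ht : 0 < t) :
    (iidLaw β).real {x | t ≤ |∑ i ∈ Finset.range n, Y (x i)|} ≤ n * Var[Y; β] / t ^ 2 := by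
  have hmp (i : ℕ) := measurePreserving_eval_infinitePi (fun _ : ℕ => β) i
  have hL (i : ℕ) : MemLp (fun x : ℕ → E => Y (x i)) 2 (iidLaw β) :=
    hY2.comp_measurePreserving (hmp i)
  have hind : iIndepFun (fun (i : ℕ) (x : ℕ → E) => Y (x i)) (iidLaw β) :=
    iIndepFun_infinitePi (P := fun _ => β) (X := fun _ => Y) fun _ => hY
  have hint (i : ℕ) : ∫ x, Y (x i) ∂(iidLaw β) = 0 := by
    rw [← h0]
    have := integral_map (μ := iidLaw β) (φ := fun x : ℕ → E => x i) (f := Y)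
      (measurable_pi_apply i).aemeasurable hY.aestronglyMeasurable
    rw [show (iidLaw β).map (fun x : ℕ → E => x i) = β from (hmp i).map_eq] at this
    exact this.symm
  have hvar (i : ℕ) : Var[fun x : ℕ → E => Y (x i); iidLaw β] = Var[Y; β] := by
    have := variance_map (μ := iidLaw β) (X := Y) (Y := fun x : ℕ → E => x i)
      hY.aemeasurable (measurable_pi_apply i).aemeasurable
    rw [show (iidLaw β).map (fun x : ℕ → E => x i) = β from (hmp i).map_eq] at this
    exact this.symm
  have hsum : MemLp (∑ i ∈ Finset.range n, fun x : ℕ → E => Y (x i)) 2 (iidLaw β) :=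
    memLp_finsetSum' _ fun i _ => hL i
  have hv := IndepFun.variance_sum (s := Finset.range n) (fun i _ => hL i)
    (fun i _ j _ hij => hind.indepFun hij)
  have hmean : ∫ x, (∑ i ∈ Finset.range n, fun x : ℕ → E => Y (x i)) x ∂(iidLaw β) = 0 := by
    simp only [Finset.sum_apply]
    rw [integral_finsetSum _ fun i _ => (hL i).integrable (by norm_num)]
    simp [hint]
  have hc := meas_ge_le_variance_div_sq hsum ht
  rw [hmean, hv] at hc
  simp only [hvar, Finset.sum_const, Finset.card_range, nsmul_eq_mul, sub_zero,
    Finset.sum_apply] at hc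
  exact ENNReal.toReal_le_of_le_ofReal (by have := variance_nonneg Y β; positivity) hc

/-- A centred square-integrable random walk stays within a fixed window at time `n` with
probability at least `exp (-η * n) / 2`, for every `η > 0` and large `n`. No lattice assumption
enters: the walk is at distance at most `θ * n * a` from the origin at time `(1 - θ) * n` by
Chebyshev's inequality, and is then steered back in the remaining `θ * n` steps, at a cost
`p ^ (θ * n)`. -/
theorem exists_exp_le_real_abs_sum_le (hY : Measurable Y) (hY2 : MemLp Y 2 β)
    (h0 : ∫ z, Y z ∂β = 0) :
    ∃ c : ℝ, 0 < c ∧ ∀ η : ℝ, 0 < η → ∀ᶠ n : ℕ in atTop,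
      Real.exp (-(η * n)) / 2 ≤ (iidLaw β).real {x | |∑ i ∈ Finset.range n, Y (x i)| ≤ c} := by
  by_cases hz : Y =ᵐ[β] 0
  · refine ⟨1, one_pos, fun η hη => Eventually.of_forall fun n => ?_⟩
    have h1 : ∀ᵐ x ∂(iidLaw β), ∀ i : ℕ, Y (x i) = 0 := by
      rw [ae_all_iff]
      intro i
      exact (measurePreserving_eval_infinitePi (fun _ : ℕ => β) i).quasiMeasurePreserving.ae hz
    have h2 : (iidLaw β).real {x | |∑ i ∈ Finset.range n, Y (x i)| ≤ 1} = 1 := by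
      rw [← probReal_univ (μ := iidLaw β)]
      refine measureReal_congr (eventuallyEq_univ.2 ?_)
      filter_upwards [h1] with x hx
      simp [hx]
    rw [h2]
    have : Real.exp (-(η * n)) ≤ 1 := Real.exp_le_one_iff.2 (by
      have : 0 ≤ η * n := by positivity
      linarith)
    linarith
  obtain ⟨a, b, p, ha, hb, hp, hp₁, hp₂⟩ := exists_steps (hY2.integrable (by norm_num)) h0 hz
  refine ⟨b, hb, fun η hη => ?_⟩
  have hp1 : p ≤ 1 := hp₁.trans measureReal_le_one
  set L := -Real.log p with hL
  have hL0 : 0 ≤ L := by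
    have := Real.log_nonpos hp.le hp1
    linarith
  -- The choice of `θ` gives `p ^ (θ * n) ≥ exp (-η * n)`.
  set θ := min 1 (η / (L + 1)) with hθ
  have hθ0 : 0 < θ := lt_min one_pos (by positivity)
  have hLθ : L * θ ≤ η := by
    calc L * θ ≤ (L + 1) * (η / (L + 1)) := by
          gcongr
          · linarith
          · exact min_le_right _ _
      _ = η := by field_simp
  have hV := variance_nonneg Y β
  have hlarge : ∀ᶠ n : ℕ in atTop, 2 / θ + 8 * Var[Y; β] / (θ * a) ^ 2 + 1 ≤ (n : ℝ) :=
    tendsto_natCast_atTop_atTop.eventually_ge_atTop _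
  filter_upwards [hlarge] with n hn
  have hV' : 0 ≤ 8 * Var[Y; β] / (θ * a) ^ 2 := by positivity
  have hθ' : 0 < 2 / θ := by positivity
  have hn0 : (0 : ℝ) < n := by linarith
  set m := ⌊θ * n⌋₊ with hm
  have hmle : (m : ℝ) ≤ θ * n := Nat.floor_le (by positivity)
  have hmn : m ≤ n := by
    have : (m : ℝ) ≤ n := hmle.trans (mul_le_of_le_one_left hn0.le (min_le_left _ _))
    exact_mod_cast this
  have hmge : θ * n / 2 ≤ m := by
    have h1 := Nat.lt_floor_add_one (θ * n)
    have h2 : 2 ≤ θ * n := by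
      have : 2 / θ ≤ n := by linarith
      rwa [div_le_iff₀' hθ0] at this
    rw [← hm] at h1
    linarith
  have hma : 0 < m * a := mul_pos (lt_of_lt_of_le (by positivity) hmge) ha
  have hcheb := real_abs_sum_ge_le hY hY2 h0 (n - m) hma
  have hbound : ((n - m : ℕ) : ℝ) * Var[Y; β] / (m * a) ^ 2 ≤ 1 / 2 := by
    have h1 : ((n - m : ℕ) : ℝ) ≤ n := by exact_mod_cast Nat.sub_le _ _
    have h2 : (θ * n / 2 * a) ^ 2 ≤ (m * a) ^ 2 := by gcongr
    have h3 : 8 * Var[Y; β] ≤ n * (θ * a) ^ 2 := by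
      rw [← div_le_iff₀ (by positivity)]
      linarith
    rw [div_le_iff₀ (by positivity)]
    nlinarith [mul_le_mul_of_nonneg_right h1 hV, mul_le_mul_of_nonneg_left h3 hn0.le]
  have hhalf : 1 / 2 ≤ (iidLaw β).real
      {x | |∑ i ∈ Finset.range (n - m), Y (x i)| ≤ b + m * a} := by
    have h1 : (iidLaw β).real Set.univ ≤
        (iidLaw β).real {x | |∑ i ∈ Finset.range (n - m), Y (x i)| ≤ b + m * a}
        + (iidLaw β).real {x | m * a ≤ |∑ i ∈ Finset.range (n - m), Y (x i)|} := by
      refine (measureReal_mono ?_).trans (measureReal_union_le _ _)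
      intro x _
      simp only [Set.mem_union, Set.mem_ofPred_eq]
      by_contra! h
      linarith
    rw [probReal_univ] at h1
    linarith
  have hfin := pow_mul_real_abs_sum_le hY hp.le hp₁ hp₂ ha m (n - m) le_rfl
  rw [Nat.sub_add_cancel hmn] at hfin
  refine le_trans ?_ hfin
  have hpm : Real.exp (-(η * n)) ≤ p ^ m := by
    rw [← Real.exp_log hp, ← Real.exp_nat_mul, Real.exp_le_exp]
    have : m * L ≤ θ * n * L := by gcongr
    nlinarith
  calc Real.exp (-(η * n)) / 2 = Real.exp (-(η * n)) * (1 / 2) := by ring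
    _ ≤ _ := by gcongr

end RandomWalk

/-! ### The empirical event and reindexing of i.i.d. sequences -/

theorem empiricalEvent_momentSet {F : E → ℝ} (hF : Measurable F) (T : Set ℝ) {n : ℕ} (hn : n ≠ 0) :
    empiricalEvent (momentSet F T) n
      = {x : ℕ → E | (n : ℝ)⁻¹ * ∑ i ∈ Finset.range n, F (x i) ∈ T} := by
  ext x
  have hn' : (n : ℝ≥0∞) ≠ 0 := by exact_mod_cast hn
  have hi : ∀ i ∈ Finset.range n, Integrable F (Measure.dirac (x i)) := fun i _ =>
    integrable_dirac' hF.stronglyMeasurable (by simp)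
  have h1 : IsProbabilityMeasure (empiricalMeasure n x) := ⟨by
    simp [empiricalMeasure, ENNReal.inv_mul_cancel hn' (ENNReal.natCast_ne_top n)]⟩
  have h2 : Integrable F (empiricalMeasure n x) :=
    ((integrable_finsetSum_measure).2 hi).smul_measure (ENNReal.inv_ne_top.2 hn')
  have h3 : ∫ z, F z ∂(empiricalMeasure n x) = (n : ℝ)⁻¹ * ∑ i ∈ Finset.range n, F (x i) := by
    rw [empiricalMeasure, integral_smul_measure, integral_finsetSum_measure hi]
    simp [integral_dirac' F _ hF.stronglyMeasurable]
  simp only [empiricalEvent, momentSet, Set.mem_ofPred_eq, h1, h2, h3, true_and]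

theorem iidLaw_map_of_injective {ι : Type*} (β : Measure E) [IsProbabilityMeasure β] {f : ι → ℕ}
    (hf : Function.Injective f) :
    (iidLaw β).map (fun x i => x (f i)) = Measure.infinitePi (fun _ : ι => β) :=
  Measure.map_infinitePi_infinitePi_of_inj (P := fun _ : ℕ => β) hf

/-! ### Change of measure -/

section ChangeOfMeasure
variable {α : Measure E} [IsProbabilityMeasure α] {F : E → ℝ} {l : ℝ}

theorem pi_tilted_mul (hF : Measurable F) (hl : l ∈ integrableExpSet F α) (n : ℕ) :
    Measure.pi (fun _ : Fin n => α.tilted (l * F ·))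
      = (Measure.pi (fun _ : Fin n => α)).withDensity
        (fun x => ENNReal.ofReal (Real.exp (l * ∑ i, F (x i) - n * cgf F α l))) := by
  have := isProbabilityMeasure_tilted_mul hl
  refine Measure.pi_eq fun s hs => ?_
  have hbox : MeasurableSet (Set.univ.pi s) := MeasurableSet.univ_pi hs
  rw [withDensity_apply _ hbox, ← lintegral_indicator hbox]
  have hprod (x : Fin n → E) : (Set.univ.pi s).indicator
      (fun x => ENNReal.ofReal (Real.exp (l * ∑ i, F (x i) - n * cgf F α l))) x
      = ∏ i, (s i).indicator
        (fun z => ENNReal.ofReal (Real.exp (l * F z - cgf F α l))) (x i) := by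
    by_cases hx : x ∈ Set.univ.pi s
    · rw [Set.indicator_of_mem hx, Finset.prod_congr rfl fun i _ =>
        Set.indicator_of_mem (hx i (Set.mem_univ i)) _,
        ← ENNReal.ofReal_prod_of_nonneg fun i _ => (Real.exp_pos _).le, ← Real.exp_sum]
      simp [Finset.mul_sum]
    · rw [Set.indicator_of_notMem hx]
      simp only [Set.mem_univ_pi, not_forall] at hx
      obtain ⟨i, hi⟩ := hx
      exact (Finset.prod_eq_zero (Finset.mem_univ i) (Set.indicator_of_notMem hi _)).symm
  have hg (i : Fin n) : Measurable ((s i).indicator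
      fun z => ENNReal.ofReal (Real.exp (l * F z - cgf F α l))) :=
    Measurable.indicator (by fun_prop) (hs i)
  have hind := iIndepFun_pi (μ := fun _ : Fin n => α) (X := fun i => (s i).indicator
      fun z => ENNReal.ofReal (Real.exp (l * F z - cgf F α l))) fun i => (hg i).aemeasurable
  simp_rw [hprod]
  rw [lintegral_prod_eq_prod_lintegral_of_indepFun Finset.univ _ hind fun i =>
    (hg i).comp (measurable_pi_apply i)]
  refine Finset.prod_congr rfl fun i _ => ?_
  rw [(measurePreserving_eval (fun _ : Fin n => α) i).lintegral_comp (hg i),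
    lintegral_indicator (hs i), tilted_mul_apply_cgf _ hl]

theorem iidLaw_real_restrict (β : Measure E) [IsProbabilityMeasure β] {n : ℕ}
    {B : Set (Fin n → E)} (hB : MeasurableSet B) :
    (iidLaw β).real {x | (fun i : Fin n => x i) ∈ B}
      = (Measure.pi fun _ : Fin n => β).real B := by
  rw [← Measure.infinitePi_eq_pi, ← iidLaw_map_of_injective β Fin.val_injective,
    map_measureReal_apply (by fun_prop) hB]
  rfl

/-- The density of the first `n` coordinates under the tilted law is
`exp (l * ∑ F (x i) - n * Λ_F(l))`; bounded below on `B`, it compares the probabilities of `B`. -/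
theorem exp_mul_iidLaw_real_le (hF : Measurable F) (hl : l ∈ integrableExpSet F α)
    [IsProbabilityMeasure (α.tilted (l * F ·))] {n : ℕ}
    {B : Set (Fin n → E)} (hB : MeasurableSet B) {r : ℝ} (h : ∀ x ∈ B, r ≤ l * ∑ i, F (x i)) :
    Real.exp (r - n * cgf F α l) * (iidLaw α).real {x | (fun i : Fin n => x i) ∈ B}
      ≤ (iidLaw (α.tilted (l * F ·))).real {x | (fun i : Fin n => x i) ∈ B} := by
  rw [iidLaw_real_restrict _ hB, iidLaw_real_restrict _ hB]
  have h1 : ENNReal.ofReal (Real.exp (r - n * cgf F α l)) * (Measure.pi fun _ : Fin n => α) B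
      ≤ (Measure.pi fun _ : Fin n => α.tilted (l * F ·)) B := by
    rw [pi_tilted_mul hF hl, withDensity_apply _ hB, ← setLIntegral_const]
    refine setLIntegral_mono' hB fun x hx => ENNReal.ofReal_le_ofReal (Real.exp_le_exp.2 ?_)
    linarith [h x hx]
  have h2 := ENNReal.toReal_mono (measure_ne_top _ _) h1
  rwa [ENNReal.toReal_mul, ENNReal.toReal_ofReal (Real.exp_pos _).le] at h2

theorem iidLaw_real_le_exp_mul (hF : Measurable F) (hl : l ∈ integrableExpSet F α)
    [IsProbabilityMeasure (α.tilted (l * F ·))] {n : ℕ}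
    {B : Set (Fin n → E)} (hB : MeasurableSet B) {r : ℝ} (h : ∀ x ∈ B, l * ∑ i, F (x i) ≤ r) :
    (iidLaw (α.tilted (l * F ·))).real {x | (fun i : Fin n => x i) ∈ B}
      ≤ Real.exp (r - n * cgf F α l) * (iidLaw α).real {x | (fun i : Fin n => x i) ∈ B} := by
  rw [iidLaw_real_restrict _ hB, iidLaw_real_restrict _ hB]
  have h1 : (Measure.pi fun _ : Fin n => α.tilted (l * F ·)) B
      ≤ ENNReal.ofReal (Real.exp (r - n * cgf F α l)) * (Measure.pi fun _ : Fin n => α) B := by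
    rw [pi_tilted_mul hF hl, withDensity_apply _ hB, ← setLIntegral_const]
    refine setLIntegral_mono' hB fun x hx => ENNReal.ofReal_le_ofReal (Real.exp_le_exp.2 ?_)
    linarith [h x hx]
  have h2 := ENNReal.toReal_mono (by finiteness) h1
  rwa [ENNReal.toReal_mul, ENNReal.toReal_ofReal (Real.exp_pos _).le] at h2

end ChangeOfMeasure

/-! ### Block averages and exchangeability -/

section Blocks
variable {k : ℕ} {D : Set (Fin k → E)}

theorem block_index_injective (k : ℕ) :
    Function.Injective fun p : ℕ × Fin k => p.1 * k + (p.2 : ℕ) := by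
  rintro ⟨j, i⟩ ⟨j', i'⟩ h
  have hk : 0 < k := i.pos
  have h : j * k + (i : ℕ) = j' * k + i' := h
  have h1 : j = j' := by
    have := congrArg (· / k) h
    simpa [Nat.add_div_of_dvd_right (Nat.dvd_mul_left k _), Nat.mul_div_cancel _ hk,
      Nat.div_eq_of_lt i.isLt, Nat.div_eq_of_lt i'.isLt] using this
  subst h1
  simpa [Fin.ext_iff] using h

/-- Disjoint blocks of `k` consecutive coordinates are independent. -/
theorem iIndepFun_blocks (β : Measure E) [IsProbabilityMeasure β] (k : ℕ) :
    iIndepFun (fun (j : ℕ) (x : ℕ → E) (i : Fin k) => x (j * k + i)) (iidLaw β) := by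
  rw [iIndepFun_iff_map_fun_eq_infinitePi_map (by fun_prop)]
  have h1 (j : ℕ) : (iidLaw β).map (fun x (i : Fin k) => x (j * k + i))
      = Measure.infinitePi fun _ : Fin k => β :=
    iidLaw_map_of_injective β fun i i' h => by simpa [Fin.ext_iff] using h
  simp_rw [h1]
  rw [← Measure.infinitePi_map_curry (fun (_ : ℕ) (_ : Fin k) => β),
    ← iidLaw_map_of_injective β (block_index_injective k), Measure.map_map (by fun_prop)
      (by fun_prop)]
  rfl

theorem iidLaw_real_block (β : Measure E) [IsProbabilityMeasure β] (hD : MeasurableSet D) (j : ℕ) :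
    (iidLaw β).real {x | (fun i : Fin k => x (j * k + i)) ∈ D}
      = (Measure.pi fun _ : Fin k => β).real D := by
  rw [← Measure.infinitePi_eq_pi, ← iidLaw_map_of_injective β (f := fun i : Fin k => j * k + i)
    (fun i i' h => by simpa [Fin.ext_iff] using h), map_measureReal_apply (by fun_prop) hD]
  rfl

/-- Hoeffding's inequality for the frequency of visits to `D` among the first `N` blocks of
length `k`; the bound does not depend on `D`. -/
theorem iidLaw_real_abs_block_sum_ge_le (β : Measure E) [IsProbabilityMeasure β]
    (hD : MeasurableSet D) (N : ℕ) {δ : ℝ} (hδ : 0 ≤ δ) :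
    (iidLaw β).real {x | N * δ ≤ |∑ j ∈ Finset.range N,
        (D.indicator (fun _ => (1 : ℝ)) (fun i : Fin k => x (j * k + i))
          - (Measure.pi fun _ : Fin k => β).real D)|}
      ≤ 2 * Real.exp (-(2 * N * δ ^ 2)) := by
  set q := (Measure.pi fun _ : Fin k => β).real D
  set Z : ℕ → (ℕ → E) → ℝ := fun j x =>
    D.indicator (fun _ => (1 : ℝ)) (fun i : Fin k => x (j * k + i)) - q with hZ
  have hind : Measurable (D.indicator (fun _ => (1 : ℝ))) := measurable_const.indicator hD
  have hZi : iIndepFun Z (iidLaw β) :=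
    (iIndepFun_blocks β k).comp (fun _ z => D.indicator (fun _ => (1 : ℝ)) z - q)
      fun _ => hind.sub_const q
  have hsub (j : ℕ) : HasSubgaussianMGF (Z j) ((‖(1 : ℝ) - 0‖₊ / 2) ^ 2) (iidLaw β) := by
    have hm : Measurable fun x : ℕ → E =>
        D.indicator (fun _ => (1 : ℝ)) (fun i : Fin k => x (j * k + i)) :=
      hind.comp (by fun_prop)
    have h1 := hasSubgaussianMGF_of_mem_Icc (μ := iidLaw β) (a := 0) (b := 1) hm.aemeasurable
      (ae_of_all _ fun x => by
        by_cases hx : (fun i : Fin k => x (j * k + i)) ∈ D <;> simp [hx])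
    have h2 : ∫ x, D.indicator (fun _ => (1 : ℝ)) (fun i : Fin k => x (j * k + i)) ∂(iidLaw β)
        = q := by
      have hDm : MeasurableSet {x : ℕ → E | (fun i : Fin k => x (j * k + i)) ∈ D} :=
        (by fun_prop : Measurable fun (x : ℕ → E) (i : Fin k) => x (j * k + i)) hD
      exact (integral_indicator_one hDm).trans (iidLaw_real_block β hD j)
    rwa [h2] at h1
  have hexp : -(N * δ) ^ 2 / (2 * N * (((‖(1 : ℝ) - 0‖₊ / 2) ^ 2 : NNReal) : ℝ))
      ≤ -(2 * N * δ ^ 2) := by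
    rcases Nat.eq_zero_or_pos N with rfl | hN
    · simp
    · have : (0 : ℝ) < N := by exact_mod_cast hN
      apply le_of_eq
      simp
      field_simp
  have hN : (0 : ℝ) ≤ N * δ := by positivity
  have hup := HasSubgaussianMGF.measure_sum_range_ge_le_of_iIndepFun hZi (n := N)
    (fun i _ => hsub i) hN
  have hZi' : iIndepFun (fun j x => -Z j x) (iidLaw β) :=
    hZi.comp (fun _ z => -z) fun _ => measurable_neg
  have hlo := HasSubgaussianMGF.measure_sum_range_ge_le_of_iIndepFun hZi' (n := N)
    (fun i _ => (hsub i).neg) hN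
  have hcover : (iidLaw β).real {x | N * δ ≤ |∑ j ∈ Finset.range N, Z j x|}
      ≤ (iidLaw β).real {x | N * δ ≤ ∑ j ∈ Finset.range N, Z j x}
        + (iidLaw β).real {x | N * δ ≤ ∑ j ∈ Finset.range N, -Z j x} := by
    refine (measureReal_mono ?_).trans (measureReal_union_le _ _)
    intro x hx
    simp only [Set.mem_ofPred_eq, Set.mem_union, Finset.sum_neg_distrib] at hx ⊢
    exact le_abs.1 hx
  have := Real.exp_le_exp.2 hexp
  linarith

/-- The map underlying `swapBlocks`. -/
def swapBlocksFun (k m i : ℕ) : ℕ :=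
  if i < k then m + i else if m ≤ i ∧ i < m + k then i - m else i

/-- The involution of `ℕ` exchanging the intervals `[0, k)` and `[m, m + k)`, for `k ≤ m`. -/
def swapBlocks (k m : ℕ) (hm : k ≤ m) : Equiv.Perm ℕ :=
  Function.Involutive.toPerm (swapBlocksFun k m) (by
    intro i
    simp only [swapBlocksFun]
    split_ifs <;> omega)

theorem swapBlocks_apply_of_lt {k m i : ℕ} (hm : k ≤ m) (hi : i < k) :
    swapBlocks k m hm i = m + i :=
  if_pos hi

theorem sum_range_swapBlocks {k m n : ℕ} (hm : k ≤ m) (hn : m + k ≤ n) (f : ℕ → ℝ) :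
    ∑ i ∈ Finset.range n, f (swapBlocks k m hm i) = ∑ i ∈ Finset.range n, f i := by
  refine Equiv.Perm.sum_comp (swapBlocks k m hm) (Finset.range n) f ?_
  intro i hi
  have hi : swapBlocksFun k m i ≠ i := hi
  simp only [Finset.coe_range, Set.mem_Iio]
  rw [swapBlocksFun] at hi
  split_ifs at hi <;> omega

/-- Exchangeability: jointly with an event on `∑ i < n, F (x i)`, all blocks inside the first `n`
coordinates have the same law. -/
theorem iidLaw_real_inter_block (α : Measure E) [IsProbabilityMeasure α] {F : E → ℝ}
    (hF : Measurable F) {T : Set ℝ} (hT : MeasurableSet T) (hD : MeasurableSet D) {n j : ℕ}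
    (hj : j * k + k ≤ n) :
    (iidLaw α).real ({x | ∑ i ∈ Finset.range n, F (x i) ∈ T} ∩
        {x | (fun i : Fin k => x (j * k + i)) ∈ D})
      = (iidLaw α).real ({x | ∑ i ∈ Finset.range n, F (x i) ∈ T} ∩
        {x | (fun i : Fin k => x i) ∈ D}) := by
  rcases Nat.eq_zero_or_pos j with rfl | hj0
  · simp
  have hm : k ≤ j * k := Nat.le_mul_of_pos_left k hj0
  set σ := swapBlocks k (j * k) hm
  have hmeas : MeasurableSet ({x : ℕ → E | ∑ i ∈ Finset.range n, F (x i) ∈ T} ∩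
      {x | (fun i : Fin k => x i) ∈ D}) := by
    refine MeasurableSet.inter ?_ ?_
    · exact (by fun_prop : Measurable fun x : ℕ → E => ∑ i ∈ Finset.range n, F (x i)) hT
    · exact (by fun_prop : Measurable fun (x : ℕ → E) (i : Fin k) => x i) hD
  have hmap : (iidLaw α).map (fun x i => x (σ i)) = iidLaw α :=
    iidLaw_map_of_injective α σ.injective
  conv_rhs => rw [← hmap, map_measureReal_apply (by fun_prop) hmeas]
  congr 1
  ext x
  simp only [Set.mem_inter_iff, Set.mem_ofPred_eq, Set.mem_preimage]
  rw [sum_range_swapBlocks hm hj fun i => F (x i)]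
  simp only [σ, swapBlocks_apply_of_lt hm (Fin.isLt _)]

/-- By exchangeability, the probability that the first block lies in `D` on the event `A` is the
integral over `A` of the frequency of blocks in `D`. This frequency is within `δ` of `q`, except on
an event where its distance to `q` is at most `1`. -/
theorem abs_iidLaw_real_inter_sub_le (α : Measure E) [IsProbabilityMeasure α] {F : E → ℝ}
    (hF : Measurable F) {T : Set ℝ} (hT : MeasurableSet T) (hD : MeasurableSet D) {n N : ℕ}
    (hN : N * k ≤ n) (hN0 : 0 < N) {q δ : ℝ} (hq : q ∈ Set.Icc (0 : ℝ) 1) (hδ : 0 ≤ δ) :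
    |(iidLaw α).real ({x | ∑ i ∈ Finset.range n, F (x i) ∈ T} ∩ {x | (fun i : Fin k => x i) ∈ D})
        - q * (iidLaw α).real {x | ∑ i ∈ Finset.range n, F (x i) ∈ T}|
      ≤ δ * (iidLaw α).real {x | ∑ i ∈ Finset.range n, F (x i) ∈ T}
        + (iidLaw α).real ({x | ∑ i ∈ Finset.range n, F (x i) ∈ T} ∩
          {x | N * δ ≤ |∑ j ∈ Finset.range N,
            (D.indicator (fun _ => (1 : ℝ)) (fun i : Fin k => x (j * k + i)) - q)|}) := by
  set P := iidLaw α
  set A : Set (ℕ → E) := {x | ∑ i ∈ Finset.range n, F (x i) ∈ T}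
  set W : (ℕ → E) → ℝ := fun x => ∑ j ∈ Finset.range N,
    (D.indicator (fun _ => (1 : ℝ)) (fun i : Fin k => x (j * k + i)) - q) with hW
  set B : Set (ℕ → E) := {x | N * δ ≤ |W x|}
  have hNr : (0 : ℝ) < N := by exact_mod_cast hN0
  have hind : Measurable (D.indicator (fun _ => (1 : ℝ))) := measurable_const.indicator hD
  have hDm (j : ℕ) : MeasurableSet {x : ℕ → E | (fun i : Fin k => x (j * k + i)) ∈ D} :=
    (by fun_prop : Measurable fun (x : ℕ → E) (i : Fin k) => x (j * k + i)) hD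
  have hb (j : ℕ) : Measurable fun x : ℕ → E =>
      D.indicator (fun _ => (1 : ℝ)) (fun i : Fin k => x (j * k + i)) :=
    hind.comp (by fun_prop)
  have hWm : Measurable W := Finset.measurable_sum _ fun j _ => (hb j).sub_const q
  have hBm : MeasurableSet B := measurableSet_le measurable_const (by fun_prop)
  have hterm (j : ℕ) (x : ℕ → E) :
      |D.indicator (fun _ => (1 : ℝ)) (fun i : Fin k => x (j * k + i)) - q| ≤ 1 := by
    rw [abs_le]
    by_cases hx : (fun i : Fin k => x (j * k + i)) ∈ D <;> simp [hx] <;>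
      constructor <;> linarith [hq.1, hq.2]
  have hWle (x : ℕ → E) : |W x| ≤ N := by
    refine (Finset.abs_sum_le_sum_abs _ _).trans ?_
    refine (Finset.sum_le_sum fun j _ => hterm j x).trans ?_
    simp
  have hWi : IntegrableOn W A P :=
    (Integrable.of_bound hWm.aestronglyMeasurable (N : ℝ) (ae_of_all _ hWle)).integrableOn
  have hti (j : ℕ) : IntegrableOn (fun x : ℕ → E =>
      D.indicator (fun _ => (1 : ℝ)) (fun i : Fin k => x (j * k + i)) - q) A P :=
    (Integrable.of_bound ((hb j).sub_const q).aestronglyMeasurable (1 : ℝ)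
      (ae_of_all _ (hterm j))).integrableOn
  have hint : ∫ x in A, W x ∂P
      = N * (P.real (A ∩ {x | (fun i : Fin k => x i) ∈ D}) - q * P.real A) := by
    have h1 (j : ℕ) (hj : j ∈ Finset.range N) : ∫ x in A,
        (D.indicator (fun _ => (1 : ℝ)) (fun i : Fin k => x (j * k + i)) - q) ∂P
        = P.real (A ∩ {x | (fun i : Fin k => x i) ∈ D}) - q * P.real A := by
      have hjn : j * k + k ≤ n := by
        have : (j + 1) * k ≤ N * k := Nat.mul_le_mul_right k (Finset.mem_range.1 hj)
        linarith
      have h2 : IntegrableOn (fun x : ℕ → E =>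
          D.indicator (fun _ => (1 : ℝ)) (fun i : Fin k => x (j * k + i))) A P :=
        ((integrable_const (1 : ℝ)).indicator (hDm j)).integrableOn
      rw [integral_sub h2 (integrable_const q), ← iidLaw_real_inter_block α hF hT hD hjn]
      congr 1
      · have h3 : (fun x : ℕ → E => D.indicator (fun _ => (1 : ℝ))
            (fun i : Fin k => x (j * k + i)))
            = {x : ℕ → E | (fun i : Fin k => x (j * k + i)) ∈ D}.indicator 1 := rfl
        rw [h3, integral_indicator_one (hDm j), measureReal_restrict_apply (hDm j), Set.inter_comm]
      · simp [mul_comm]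
    rw [hW, integral_finsetSum _ fun j _ => hti j, Finset.sum_congr rfl h1,
      Finset.sum_const, Finset.card_range, nsmul_eq_mul]
  have hBi : Integrable (fun x => N * B.indicator (1 : (ℕ → E) → ℝ) x) (P.restrict A) :=
    ((integrable_const (1 : ℝ)).indicator hBm).const_mul _
  have hbound : |∫ x in A, W x ∂P| ≤ N * (δ * P.real A + P.real (A ∩ B)) := by
    calc |∫ x in A, W x ∂P| ≤ ∫ x in A, |W x| ∂P := abs_integral_le_integral_abs
      _ ≤ ∫ x in A, (N * δ + N * B.indicator 1 x) ∂P := by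
        refine integral_mono hWi.abs ?_ fun x => ?_
        · exact (integrable_const _).add hBi
        · by_cases hx : x ∈ B
          · have : 0 ≤ N * δ := by positivity
            simp only [hx, Set.indicator_of_mem, Pi.one_apply, mul_one]
            linarith [hWle x]
          · have h : |W x| < N * δ := not_le.1 fun h => hx h
            simp only [hx, not_false_eq_true, Set.indicator_of_notMem, mul_zero, add_zero]
            exact h.le
      _ = _ := by
        rw [integral_add (integrable_const _) hBi, integral_const, integral_const_mul,
          integral_indicator_one hBm, measureReal_restrict_apply hBm, Set.inter_comm]
        simp
        ring
  rw [hint, abs_mul, abs_of_pos hNr] at hbound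
  exact le_of_mul_le_mul_left hbound hNr

end Blocks

/-! ### The conditional law -/

theorem measurableSet_sum_event {F : E → ℝ} (hF : Measurable F) {T : Set ℝ}
    (hT : MeasurableSet T) (n : ℕ) :
    MeasurableSet {x : ℕ → E | ∑ i ∈ Finset.range n, F (x i) ∈ T} :=
  (by fun_prop : Measurable fun x : ℕ → E => ∑ i ∈ Finset.range n, F (x i)) hT

theorem condLaw_real {α : Measure E} [IsProbabilityMeasure α] {F : E → ℝ} {C : Set (Measure E)}
    {T : Set ℝ} {n k : ℕ}
    (hA : empiricalEvent C n = {x : ℕ → E | ∑ i ∈ Finset.range n, F (x i) ∈ T})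
    (hF : Measurable F) (hT : MeasurableSet T) {D : Set (Fin k → E)} (hD : MeasurableSet D) :
    (condLaw α C n k).real D
      = ((iidLaw α).real {x | ∑ i ∈ Finset.range n, F (x i) ∈ T})⁻¹
        * (iidLaw α).real ({x | ∑ i ∈ Finset.range n, F (x i) ∈ T} ∩
          {x | (fun i : Fin k => x i) ∈ D}) := by
  rw [condLaw, hA, map_measureReal_apply (by fun_prop) hD,
    measureReal_def, cond_apply (measurableSet_sum_event hF hT n), ENNReal.toReal_mul,
    ENNReal.toReal_inv]
  rfl

section ConditionalLaw
variable {α : Measure E} [IsProbabilityMeasure α] {F : E → ℝ} {l : ℝ}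

/-- Lower bound for the probability of the conditioning event under `α` by the probability that
the walk with centred steps `F - m` lies in `[-c, c]` under the tilted law. -/
theorem tilted_real_window_le (hF : Measurable F) (hl : l ∈ integrableExpSet F α)
    [IsProbabilityMeasure (α.tilted (l * F ·))] {T : Set ℝ} {n : ℕ} {m e c : ℝ}
    (hTc : ∀ s, |s - n * m| ≤ c → s ∈ T) (hc : |l| * c ≤ n * e) :
    (iidLaw (α.tilted (l * F ·))).real {x | |∑ i ∈ Finset.range n, (F (x i) - m)| ≤ c}
      ≤ Real.exp (n * (l * m + e) - n * cgf F α l)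
        * (iidLaw α).real {x | ∑ i ∈ Finset.range n, F (x i) ∈ T} := by
  have h1 := iidLaw_real_le_exp_mul hF hl (n := n) (B := {x | |∑ i, F (x i) - n * m| ≤ c})
    (measurableSet_le (by fun_prop) measurable_const) (r := n * (l * m + e)) fun x hx => by
      have hx : |∑ i, F (x i) - n * m| ≤ c := hx
      have h2 : l * (∑ i, F (x i) - n * m) ≤ |l| * c := by
        refine (le_abs_self _).trans ?_
        rw [abs_mul]
        gcongr
      linarith
  have e1 : {x : ℕ → E | (fun i : Fin n => x i) ∈ {x : Fin n → E | |∑ i, F (x i) - n * m| ≤ c}}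
      = {x | |∑ i ∈ Finset.range n, (F (x i) - m)| ≤ c} := by
    ext x
    simp [Finset.sum_range fun i => F (x i)]
  rw [e1] at h1
  refine h1.trans (mul_le_mul_of_nonneg_left (measureReal_mono fun x hx => hTc _ ?_)
    (Real.exp_pos _).le)
  simpa using hx

theorem iidLaw_real_pos_of_tilted (hF : Measurable F) (hl : l ∈ integrableExpSet F α)
    [IsProbabilityMeasure (α.tilted (l * F ·))] {T : Set ℝ} {n : ℕ} {m e c : ℝ}
    (hTc : ∀ s, |s - n * m| ≤ c → s ∈ T) (hc : |l| * c ≤ n * e)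
    (hpos : 0 < (iidLaw (α.tilted (l * F ·))).real
      {x | |∑ i ∈ Finset.range n, (F (x i) - m)| ≤ c}) :
    0 < (iidLaw α).real {x | ∑ i ∈ Finset.range n, F (x i) ∈ T} :=
  pos_of_mul_pos_right (hpos.trans_le (tilted_real_window_le hF hl hTc hc)) (Real.exp_pos _).le

/-- Conditionally on `∑ i < n, F (x i) ∈ T`, an event `B` on the first `n` coordinates has
probability at most `exp (2 * n * e)` times its probability under the tilted law, divided by the
probability that the centred walk lies in `[-c, c]`. -/
theorem iidLaw_real_inter_mul_le (hF : Measurable F)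
    (hl : l ∈ integrableExpSet F α) [IsProbabilityMeasure (α.tilted (l * F ·))] {T : Set ℝ}
    (hT : MeasurableSet T) {n : ℕ} {m e c : ℝ} (hTl : ∀ s ∈ T, n * (l * m - e) ≤ l * s)
    (hTc : ∀ s, |s - n * m| ≤ c → s ∈ T) (hc : |l| * c ≤ n * e)
    {B : Set (Fin n → E)} (hB : MeasurableSet B) :
    (iidLaw α).real ({x | ∑ i ∈ Finset.range n, F (x i) ∈ T} ∩ {x | (fun i : Fin n => x i) ∈ B})
        * (iidLaw (α.tilted (l * F ·))).real {x | |∑ i ∈ Finset.range n, (F (x i) - m)| ≤ c}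
      ≤ Real.exp (2 * n * e)
        * (iidLaw (α.tilted (l * F ·))).real {x | (fun i : Fin n => x i) ∈ B}
        * (iidLaw α).real {x | ∑ i ∈ Finset.range n, F (x i) ∈ T} := by
  set β := α.tilted (l * F ·)
  set Λ := cgf F α l
  have hS : Measurable fun x : Fin n → E => ∑ i, F (x i) := by fun_prop
  have h1 := exp_mul_iidLaw_real_le hF hl (B := {x | ∑ i, F (x i) ∈ T} ∩ B) ((hS hT).inter hB)
    (r := n * (l * m - e)) fun x hx => hTl _ hx.1
  have e1 : {x : ℕ → E | (fun i : Fin n => x i) ∈ {x : Fin n → E | ∑ i, F (x i) ∈ T} ∩ B}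
      = {x | ∑ i ∈ Finset.range n, F (x i) ∈ T} ∩ {x | (fun i : Fin n => x i) ∈ B} := by
    ext x
    simp [Finset.sum_range fun i => F (x i)]
  rw [e1] at h1
  have h2 := h1.trans (measureReal_mono Set.inter_subset_right)
  have h3 := tilted_real_window_le hF hl hTc hc
  set u := (iidLaw α).real ({x | ∑ i ∈ Finset.range n, F (x i) ∈ T} ∩
      {x | (fun i : Fin n => x i) ∈ B})
  set w := (iidLaw β).real {x | (fun i : Fin n => x i) ∈ B}
  set z := (iidLaw α).real {x | ∑ i ∈ Finset.range n, F (x i) ∈ T}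
  have hu : 0 ≤ u := measureReal_nonneg
  have hz : 0 ≤ z := measureReal_nonneg
  have h4 : Real.exp (n * (l * m + e) - n * Λ)
      = Real.exp (2 * n * e) * Real.exp (n * (l * m - e) - n * Λ) := by
    rw [← Real.exp_add]
    congr 1
    ring
  calc _ ≤ u * (Real.exp (n * (l * m + e) - n * Λ) * z) := mul_le_mul_of_nonneg_left h3 hu
    _ = Real.exp (2 * n * e) * (Real.exp (n * (l * m - e) - n * Λ) * u) * z := by
      rw [h4]
      ring
    _ ≤ Real.exp (2 * n * e) * w * z := by gcongr

/-- The distance between the conditional law of the first `k` coordinates and the product of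
tilted laws on a set `D`, uniformly in `D`: the error `δ` of the block frequency, plus the
exponentially small probability of a larger error. -/
theorem abs_inv_mul_sub_pi_le (hF : Measurable F)
    (hl : l ∈ integrableExpSet F α) [IsProbabilityMeasure (α.tilted (l * F ·))] {T : Set ℝ}
    (hT : MeasurableSet T) {n k N : ℕ} (hN : N * k ≤ n) (hN0 : 0 < N)
    {m e c : ℝ} (hTl : ∀ s ∈ T, n * (l * m - e) ≤ l * s)
    (hTc : ∀ s, |s - n * m| ≤ c → s ∈ T) (hc : |l| * c ≤ n * e) {δ η : ℝ} (hδ : 0 ≤ δ)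
    (hη : Real.exp (-(η * n)) / 2 ≤ (iidLaw (α.tilted (l * F ·))).real
      {x | |∑ i ∈ Finset.range n, (F (x i) - m)| ≤ c})
    {D : Set (Fin k → E)} (hD : MeasurableSet D) :
    |((iidLaw α).real {x | ∑ i ∈ Finset.range n, F (x i) ∈ T})⁻¹
        * (iidLaw α).real ({x | ∑ i ∈ Finset.range n, F (x i) ∈ T} ∩
          {x | (fun i : Fin k => x i) ∈ D})
        - (Measure.pi fun _ : Fin k => α.tilted (l * F ·)).real D|
      ≤ δ + 4 * Real.exp (2 * n * e + η * n - 2 * N * δ ^ 2) := by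
  set β := α.tilted (l * F ·)
  set q := (Measure.pi fun _ : Fin k => β).real D
  have hz := iidLaw_real_pos_of_tilted hF hl hTc hc (lt_of_lt_of_le (by positivity) hη)
  have h1 := abs_iidLaw_real_inter_sub_le α hF hT hD hN hN0 (q := q)
    ⟨measureReal_nonneg, measureReal_le_one⟩ hδ
  have h2 := iidLaw_real_abs_block_sum_ge_le β hD N hδ
  -- The deviation event of the block averages is determined by the first `n` coordinates.
  have hidx (j : Fin N) (i : Fin k) : (j : ℕ) * k + i < n := by
    have : ((j : ℕ) + 1) * k ≤ N * k := Nat.mul_le_mul_right k j.isLt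
    have := i.isLt
    linarith
  set B : Set (Fin n → E) := {y | N * δ ≤ |∑ j : Fin N,
    (D.indicator (fun _ => (1 : ℝ)) (fun i : Fin k => y ⟨j * k + i, hidx j i⟩) - q)|} with hBdef
  have hB : MeasurableSet B := by
    refine measurableSet_le measurable_const ?_
    refine (continuous_abs.measurable).comp (Finset.measurable_sum _ fun j _ => ?_)
    refine Measurable.sub_const (Measurable.comp (measurable_const.indicator hD) ?_) q
    fun_prop
  have hBe : {x : ℕ → E | N * δ ≤ |∑ j ∈ Finset.range N,
      (D.indicator (fun _ => (1 : ℝ)) (fun i : Fin k => x (j * k + i)) - q)|}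
      = {x : ℕ → E | (fun i : Fin n => x i) ∈ B} := by
    ext x
    simp only [hBdef, Set.mem_ofPred_eq, Finset.sum_range]
  rw [hBe] at h1 h2
  have h3 := iidLaw_real_inter_mul_le hF hl hT hTl hTc hc hB
  set z := (iidLaw α).real {x | ∑ i ∈ Finset.range n, F (x i) ∈ T}
  set v := (iidLaw β).real {x | |∑ i ∈ Finset.range n, (F (x i) - m)| ≤ c}
  set w := (iidLaw β).real {x | (fun i : Fin n => x i) ∈ B}
  set u := (iidLaw α).real ({x | ∑ i ∈ Finset.range n, F (x i) ∈ T} ∩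
    {x | (fun i : Fin n => x i) ∈ B})
  set d := (iidLaw α).real ({x | ∑ i ∈ Finset.range n, F (x i) ∈ T} ∩
    {x | (fun i : Fin k => x i) ∈ D})
  have hu : u ≤ 4 * Real.exp (2 * n * e + η * n - 2 * N * δ ^ 2) * z := by
    have h4 : u * (Real.exp (-(η * n)) / 2)
        ≤ Real.exp (2 * n * e) * (2 * Real.exp (-(2 * N * δ ^ 2))) * z :=
      calc u * (Real.exp (-(η * n)) / 2) ≤ u * v :=
            mul_le_mul_of_nonneg_left hη measureReal_nonneg
        _ ≤ _ := h3.trans (by gcongr)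
    have h5 : Real.exp (2 * n * e + η * n - 2 * N * δ ^ 2) * Real.exp (-(η * n))
        = Real.exp (2 * n * e) * Real.exp (-(2 * N * δ ^ 2)) := by
      rw [← Real.exp_add, ← Real.exp_add]
      congr 1
      ring
    refine le_of_mul_le_mul_right ?_ (by positivity : 0 < Real.exp (-(η * n)) / 2)
    linear_combination h4 - 2 * z * h5
  have h6 : z⁻¹ * d - q = z⁻¹ * (d - q * z) := by
    field_simp
  rw [h6, abs_mul, abs_of_pos (inv_pos.2 hz), inv_mul_le_iff₀ hz]
  linarith

end ConditionalLaw

end GibbsMoment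

open GibbsMoment in
theorem theorem3p7 {E : Type*} [TopologicalSpace E] [PolishSpace E] [MeasurableSpace E]
    [BorelSpace E] (α : Measure E) [IsProbabilityMeasure α]
    (F : E → ℝ) (hF : Measurable F)
    (K : Set ℝ) (hK_ne : K.Nonempty) (hK_closed : IsClosed K) (hK_convex : Convex ℝ K)
    (hF_exp : ∃ s : ℝ, 0 < s ∧ Integrable (fun x => Real.exp (s * |F x|)) α)
    (hdom_ne : (GibbsMoment.domLogLaplace α F).Nonempty)
    (hdom_open : IsOpen (GibbsMoment.domLogLaplace α F))
    (hHK : ∃ l₀ : ℝ, ∀ l : ℝ,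
      GibbsMoment.dualFunction α F K l₀ ≤ GibbsMoment.dualFunction α F K l) :
    ∃ αstar : Measure E,
      GibbsMoment.IsIProjection (GibbsMoment.momentSet F K) α αstar ∧
      ∃ c : ℝ, 0 < c ∧ ∀ ε : ℕ → ℝ, (∀ n : ℕ, 1 ≤ n → c / n < ε n) →
        Tendsto ε atTop (𝓝 0) →
        (∀ᶠ n in atTop, 0 < GibbsMoment.iidLaw α (GibbsMoment.empiricalEvent
          (GibbsMoment.momentSet F (Metric.cthickening (ε n) K)) n)) ∧
        ∀ k : ℕ, 1 ≤ k →
          Tendsto (fun n : ℕ => GibbsMoment.tvDist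
            (GibbsMoment.condLaw α (GibbsMoment.momentSet F (Metric.cthickening (ε n) K)) n k)
            (Measure.pi (fun _ : Fin k => αstar))) atTop (𝓝 0) := by
  obtain ⟨l, hmin⟩ := hHK
  obtain ⟨hl, s, hs, hs'⟩ := exists_cgf_sub_le_of_dualFunction_le hF hK_ne hmin
  rw [domLogLaplace_eq_integrableExpSet hF] at hdom_open
  have hli : l ∈ interior (integrableExpSet F α) := by rwa [hdom_open.interior_eq]
  obtain ⟨hmK, hmle⟩ := deriv_cgf_of_dual_minimizer hK_closed hK_convex hli hs hs'
  rw [← integral_tilted_mul_self hli] at hmK hmle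
  have hβ : IsProbabilityMeasure (α.tilted (l * F ·)) := isProbabilityMeasure_tilted_mul hl
  have hL2 : MemLp F 2 (α.tilted (l * F ·)) := memLp_tilted_mul hli 2
  set β := α.tilted (l * F ·)
  set m := ∫ x, F x ∂β
  have hFi : Integrable F β := hL2.integrable (by norm_num)
  refine ⟨β, isIProjection_tilted hl hFi hmK hmle, ?_⟩
  obtain ⟨c, hc0, hc⟩ := exists_exp_le_real_abs_sum_le (β := β) (Y := fun z => F z - m)
    (by fun_prop) (hL2.sub (memLp_const m)) (by
      rw [integral_sub hFi (integrable_const m)]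
      simp [m])
  refine ⟨c, hc0, fun ε hε hε0 => ?_⟩
  set T : ℕ → Set ℝ := fun n => {s | (n : ℝ)⁻¹ * s ∈ Metric.cthickening (ε n) K} with hT
  have hTm (n : ℕ) : MeasurableSet (T n) :=
    (measurable_const_mul _) (Metric.isClosed_cthickening).measurableSet
  have hev (n : ℕ) (hn : 1 ≤ n) :
      empiricalEvent (momentSet F (Metric.cthickening (ε n) K)) n
        = {x : ℕ → E | ∑ i ∈ Finset.range n, F (x i) ∈ T n} :=
    empiricalEvent_momentSet hF _ (by omega)
  have hTl (n : ℕ) (hn : 1 ≤ n) (s : ℝ) (hsT : s ∈ T n) : n * (l * m - |l| * ε n) ≤ l * s := by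
    have hn0 : (0 : ℝ) < n := by exact_mod_cast hn
    have hεn : 0 ≤ ε n := (lt_trans (by positivity) (hε n hn)).le
    have hsT : (n : ℝ)⁻¹ * s ∈ Metric.cthickening (ε n) K := hsT
    rw [hK_closed.cthickening_eq_biUnion_closedBall hεn] at hsT
    simp only [Set.mem_iUnion, Metric.mem_closedBall, Real.dist_eq, exists_prop] at hsT
    obtain ⟨y, hy, hsy⟩ := hsT
    have h1 : -(|l| * ε n) ≤ l * ((n : ℝ)⁻¹ * s - y) := by
      refine le_trans (neg_le_neg ?_) (neg_abs_le _)
      rw [abs_mul]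
      gcongr
    have h2 : l * s = n * (l * ((n : ℝ)⁻¹ * s)) := by field_simp
    rw [h2]
    have := hmle y hy
    gcongr
    linarith
  have hTc (n : ℕ) (hn : 1 ≤ n) (s : ℝ) (hsc : |s - n * m| ≤ c) : s ∈ T n := by
    have hn0 : (0 : ℝ) < n := by exact_mod_cast hn
    refine Metric.mem_cthickening_of_dist_le _ m _ _ hmK ?_
    rw [Real.dist_eq, show (n : ℝ)⁻¹ * s - m = (s - n * m) / n by field_simp, abs_div,
      abs_of_pos hn0]
    refine le_trans ?_ (hε n hn).le
    gcongr
  have hlc (n : ℕ) (hn : 1 ≤ n) : |l| * c ≤ n * (|l| * ε n) := by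
    have hn0 : (0 : ℝ) < n := by exact_mod_cast hn
    have := (div_lt_iff₀ hn0).1 (hε n hn)
    nlinarith [abs_nonneg l]
  constructor
  · filter_upwards [hc 1 one_pos, eventually_ge_atTop 1] with n hn hn1
    rw [hev n hn1]
    have := iidLaw_real_pos_of_tilted hF hl (hTc n hn1) (hlc n hn1)
      (lt_of_lt_of_le (by positivity) hn)
    exact (ENNReal.toReal_pos_iff.1 this).1
  intro k hk
  have hk0 : (0 : ℝ) < k := by exact_mod_cast hk
  rw [Metric.tendsto_nhds]
  intro δ' hδ'
  set δ := δ' / 3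
  have hδ : 0 < δ := by positivity
  -- With `N = n / k ≥ n / (2 * k)` blocks, the Hoeffding exponent `2 * N * δ ^ 2` is at least
  -- `4 * η * n`, while the two losses amount to at most `η * n` each.
  set η := δ ^ 2 / (4 * k)
  have hη : 0 < η := by positivity
  have hlim1 : ∀ᶠ n in atTop, 2 * (|l| * ε n) < η := by
    have : Tendsto (fun n => 2 * (|l| * ε n)) atTop (𝓝 (2 * (|l| * 0))) :=
      (hε0.const_mul _).const_mul _
    exact this.eventually_lt_const (by simpa using hη)
  have hlim2 : ∀ᶠ n : ℕ in atTop, 4 * Real.exp (-(2 * η * n)) < δ := by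
    have h1 : Tendsto (fun n : ℕ => -(2 * η * (n : ℝ))) atTop atBot :=
      tendsto_neg_atTop_atBot.comp (tendsto_natCast_atTop_atTop.const_mul_atTop (by positivity))
    have h2 := (Real.tendsto_exp_atBot.comp h1).const_mul 4
    rw [mul_zero] at h2
    exact h2.eventually_lt_const hδ
  filter_upwards [hlim1, hlim2, hc η hη, eventually_ge_atTop (2 * k)] with n h1 h2 h3 hn
  have hn1 : 1 ≤ n := by omega
  have hn0 : (0 : ℝ) < n := by exact_mod_cast hn1
  have hN0 : 0 < n / k := Nat.div_pos (by omega) (by omega)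
  have hNge : (n : ℝ) ≤ 2 * (k * (n / k : ℕ)) := by
    have h4 := Nat.lt_div_mul_add (a := n) (b := k) (by omega)
    have h5 : n ≤ 2 * (k * (n / k)) := by
      rw [mul_comm k]
      have := (Nat.le_div_iff_mul_le (by omega)).2 hn
      nlinarith
    exact_mod_cast h5
  rw [Real.dist_eq, sub_zero, abs_of_nonneg (tvDist_nonneg _ _)]
  refine lt_of_le_of_lt (b := δ + δ) (tvDist_le fun D hD => ?_) (by
    simp only [δ]
    linarith)
  rw [condLaw_real (hev n hn1) hF (hTm n) hD]
  refine (abs_inv_mul_sub_pi_le hF hl (hTm n) (Nat.div_mul_le_self n k) hN0 (hTl n hn1) (hTc n hn1)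
    (hlc n hn1) hδ.le h3 hD).trans ?_
  gcongr
  refine le_trans ?_ h2.le
  gcongr
  have h6 : 4 * η * n ≤ 2 * (n / k : ℕ) * δ ^ 2 := by
    have : 4 * η * n = δ ^ 2 / k * n := by
      simp only [η]
      field_simp
    rw [this, div_mul_eq_mul_div, div_le_iff₀ hk0]
    nlinarith [sq_nonneg δ]
  nlinarith
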